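/- \textbf{Theorem (Exact convex reformulation).} Let $n\ge 1$, $r\ge 0$ and $X,Z\in\mathbb{R}^{n\times r}$. For a linear map $\mathcal{A}:\mathbb{R}^{n\times n}\to\mathbb{R}^m$ put $f_{\mathcal A}(Y)=\tfrac12\|\mathcal{A}(YY^T-ZZ^T)\|^2$ for $Y\in\mathbb{R}^{n\times r}$, and let $\mathbf{H}=\mathcal{A}^T\mathcal{A}\in\mathbb{R}^{n^2\times n^2}$ denote the matrix of the kernel operator with respect to vectorization, i.e. $\mathbf H=\mathbf A^T\mathbf A$ where $\mathbf A\,\mathrm{vec}(M)=\mathcal A(M)$ for all $M$. Say that $\mathcal A$ satisfies the restricted isometry property (RIP) with constant $\delta\ge 0$ if $$(1-\delta)\|M\|_F^2\le\|\mathcal A(M)\|^2\le(1+\delta)\|M\|_F^2\quad\text{for all } M\in\mathbb{R}^{n\times n}\text{ with } \operatorname{rank} M\le 2r .$$ Consider the two problems $$\delta(X,Z)=\min_{\delta,\,m,\,\mathcal A}\ \delta\quad\text{s.t.}\quad \nabla f_{\mathcal A}(X)=0,\ \nabla^2 f_{\mathcal A}(X)\succeq0,\ \mathcal A\text{ satisfies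 RIP with constant }\delta\ge 0,$$ $$\mathrm{LMI}(X,Z)=\min_{\delta,\ \mathbf H=\mathcal A^T\mathcal A}\ \delta\quad\text{s.t.}\quad \nabla f_{\mathcal A}(X)=0,\ \nabla^2 f_{\mathcal A}(X)\succeq0,\ (1-\delta)I\preceq\mathbf H\preceq(1+\delta)I,$$ where the number $m\in\mathbb{N}$ of measurements is free, and in the second problem $\delta\in\mathbb R$ and $\mathbf H$ ranges over all matrices of the form $\mathcal A^T\mathcal A$. Then: \begin{itemize} \item Both minima are attained, and $\delta(X,Z)=\mathrm{LMI}(X,Z)$. \item If $\mathbf H^\star$ is a minimizer of the second problem, then there is a minimizer $\mathcal A^\star$ of the first problem with $\mathbf H^\star=(\mathcal A^\star)^T\mathcal A^\star$; moreover, every $\mathcal A^\star$ with $\mathbf H^\star=(\mathcal A^\star)^T\mathcal A^\star$ is a minimizer of the first problem. \item The second problem is a convex linear matrix inequality problem: the set of its feasible pairs $(\delta,\mathbf H)$ is convex and consists exactly of the pairs with $$\mathbf H\succeq 0,\qquad \mathbf X^T\mathbf H\mathbf e=0,\qquad I_r\otimes(S+S^T)+\mathbf X^T\mathbf H\mathbf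 X\succeq0,\qquad (1-\delta)I\preceq\mathbf H\preceq(1+\delta)I,$$ where $\mathbf e=\mathrm{vec}(XX^T-ZZ^T)$, $S=\mathrm{mat}(\mathbf H\mathbf e)$ is the $n\times n$ matrix with $\mathrm{vec}(S)=\mathbf{He}$, and $\mathbf X$ is the matrix with $\mathbf X\,\mathrm{vec}(U)=\mathrm{vec}(XU^T+UX^T)$ for all $U\in\mathbb{R}^{n\times r}$. \end{itemize} -/

import Mathlib

open scoped Kronecker Matrix

/- Matrices carry the Frobenius norm `‖M‖² = ∑ᵢⱼ Mᵢⱼ²`. -/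
attribute [local instance] Matrix.frobeniusNormedAddCommGroup Matrix.frobeniusNormedSpace

namespace LowRankRecovery

/-- Linear measurement operators `𝒜 : ℝⁿˣⁿ → ℝᵐ`, with the Euclidean norm on `ℝᵐ`. -/
abbrev Meas (n m : ℕ) : Type :=
  Matrix (Fin n) (Fin n) ℝ →ₗ[ℝ] EuclideanSpace ℝ (Fin m)

/-- Square matrices of order `n²`, acting on the vectorizations of `n × n` matrices. -/
abbrev BigMat (n : ℕ) : Type :=
  Matrix (Fin n × Fin n) (Fin n × Fin n) ℝ

/-- The nonconvex objective `f(X) = ½ ‖𝒜(XXᵀ - ZZᵀ)‖²` with ground truth `ZZᵀ`. -/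
noncomputable def obj {n r m : ℕ} (A : Meas n m) (Z X : Matrix (Fin n) (Fin r) ℝ) : ℝ :=
  (1 / 2) * ‖A (X * Xᵀ - Z * Zᵀ)‖ ^ 2

/-- `X` is a second-order critical point of `g`: `∇g(X) = 0` and `∇²g(X) ⪰ 0`. -/
def IsSecondOrderCritical {n r : ℕ} (g : Matrix (Fin n) (Fin r) ℝ → ℝ)
    (X : Matrix (Fin n) (Fin r) ℝ) : Prop :=
  fderiv ℝ g X = 0 ∧ ∀ U : Matrix (Fin n) (Fin r) ℝ, 0 ≤ fderiv ℝ (fderiv ℝ g) X U U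

/-- The restricted isometry inequality with constant `δ ≥ 0` over all matrices of rank at most
`2r`. No upper bound is put on `δ`. -/
def RIP {n m : ℕ} (r : ℕ) (δ : ℝ) (A : Meas n m) : Prop :=
  0 ≤ δ ∧ ∀ M : Matrix (Fin n) (Fin n) ℝ, M.rank ≤ 2 * r →
    (1 - δ) * ‖M‖ ^ 2 ≤ ‖A M‖ ^ 2 ∧ ‖A M‖ ^ 2 ≤ (1 + δ) * ‖M‖ ^ 2

/-- The `m × n²` matrix representation of `𝒜`, with `𝐀 vec(M) = 𝒜(M)`. -/
noncomputable def measMatrix {n m : ℕ} (A : Meas n m) : Matrix (Fin m) (Fin n × Fin n) ℝ :=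
  Matrix.of fun i p => A (Matrix.single p.2 p.1 1) i

theorem measMatrix_mulVec_vec {n m : ℕ} (A : Meas n m) (M : Matrix (Fin n) (Fin n) ℝ) :
    measMatrix A *ᵥ M.vec = A M := by
  ext i
  conv_rhs => rw [Matrix.matrix_eq_sum_single M]
  simp only [map_sum, Matrix.mulVec, dotProduct, measMatrix, Matrix.of_apply, Matrix.vec]
  rw [Fintype.sum_prod_type, Finset.sum_comm]
  have h : ∀ a b, A (Matrix.single a b (M a b)) = M a b • A (Matrix.single a b 1) := by
    intro a b
    rw [← map_smul, Matrix.smul_single, smul_eq_mul, mul_one]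
  simp [h, mul_comm]

/-- The (matrix representation of the) kernel operator `𝐇 = 𝒜ᵀ𝒜`. -/
noncomputable def kernelMatrix {n m : ℕ} (A : Meas n m) : BigMat n :=
  (measMatrix A)ᵀ * measMatrix A

/-- The order bounds `(1 - δ) I ⪯ 𝐇 ⪯ (1 + δ) I`. -/
def LoewnerBounds {n : ℕ} (δ : ℝ) (H : BigMat n) : Prop :=
  (H - (1 - δ) • (1 : BigMat n)).PosSemidef ∧ ((1 + δ) • (1 : BigMat n) - H).PosSemidef

/-- `(δ, 𝒜)` is feasible for the nonconvex problem that defines `δ(X, Z)`. -/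
def RIPFeasible {n r m : ℕ} (X Z : Matrix (Fin n) (Fin r) ℝ) (δ : ℝ) (A : Meas n m) : Prop :=
  IsSecondOrderCritical (obj A Z) X ∧ RIP r δ A

/-- `(δ, 𝐇)` is feasible for the problem that defines `LMI(X, Z)`. -/
def LMIFeasible {n r : ℕ} (X Z : Matrix (Fin n) (Fin r) ℝ) (δ : ℝ) (H : BigMat n) : Prop :=
  ∃ (m : ℕ) (A : Meas n m), H = kernelMatrix A ∧
    IsSecondOrderCritical (obj A Z) X ∧ LoewnerBounds δ H

/-- The optimal value `δ(X, Z)`; the number `m` of measurements is free. -/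
noncomputable def deltaValue {n r : ℕ} (X Z : Matrix (Fin n) (Fin r) ℝ) : ℝ :=
  sInf {δ : ℝ | ∃ (m : ℕ) (A : Meas n m), RIPFeasible X Z δ A}

/-- The optimal value `LMI(X, Z)`. -/
noncomputable def lmiValue {n r : ℕ} (X Z : Matrix (Fin n) (Fin r) ℝ) : ℝ :=
  sInf {δ : ℝ | ∃ H : BigMat n, LMIFeasible X Z δ H}

/-- `𝐞 = vec(XXᵀ - ZZᵀ)`. -/
def errVec {n r : ℕ} (X Z : Matrix (Fin n) (Fin r) ℝ) : Fin n × Fin n → ℝ :=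
  (X * Xᵀ - Z * Zᵀ).vec

/-- The matrix `𝐗` with `𝐗 vec(U) = vec(XUᵀ + UXᵀ)` for all `U`. -/
noncomputable def jacMatrix {n r : ℕ} (X : Matrix (Fin n) (Fin r) ℝ) :
    Matrix (Fin n × Fin n) (Fin r × Fin n) ℝ :=
  Matrix.of fun q p =>
    (X * (Matrix.single p.2 p.1 (1 : ℝ))ᵀ + Matrix.single p.2 p.1 (1 : ℝ) * Xᵀ).vec q

theorem jacMatrix_mulVec_vec {n r : ℕ} (X U : Matrix (Fin n) (Fin r) ℝ) :
    jacMatrix X *ᵥ U.vec = (X * Uᵀ + U * Xᵀ).vec := by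
  ext q
  simp only [Matrix.mulVec, dotProduct, jacMatrix, Matrix.of_apply, Matrix.vec]
  rw [Fintype.sum_prod_type, Finset.sum_comm]
  conv_rhs => rw [Matrix.matrix_eq_sum_single U]
  have h : ∀ a b, Matrix.single a b (U a b) = U a b • (Matrix.single a b 1 : Matrix _ _ ℝ) := by
    intro a b
    rw [Matrix.smul_single, smul_eq_mul, mul_one]
  simp only [h, Matrix.transpose_sum, Matrix.transpose_smul, Matrix.mul_sum, Matrix.sum_mul,
    Matrix.mul_smul, Matrix.smul_mul, Matrix.add_apply, Matrix.sum_apply, Matrix.smul_apply,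
    smul_eq_mul, ← Finset.sum_add_distrib]
  refine Finset.sum_congr rfl fun a _ => Finset.sum_congr rfl fun b _ => ?_
  ring

/-- Matricization, the inverse of the vectorization `Matrix.vec` that stacks columns. -/
def matOf {n : ℕ} (v : Fin n × Fin n → ℝ) : Matrix (Fin n) (Fin n) ℝ :=
  Matrix.of fun i j => v (j, i)

theorem matOf_vec {n : ℕ} (M : Matrix (Fin n) (Fin n) ℝ) : matOf M.vec = M := rfl

/-- The matrix of the Hessian, `I_r ⊗ (S + Sᵀ) + 𝐗ᵀ𝐇𝐗` with `S = mat(𝐇𝐞)`. (If `S` is symmetric,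
the first summand is `2 (I_r ⊗ S)`.) -/
noncomputable def hessMatrix {n r : ℕ} (X Z : Matrix (Fin n) (Fin r) ℝ) (H : BigMat n) :
    Matrix (Fin r × Fin n) (Fin r × Fin n) ℝ :=
  (1 : Matrix (Fin r) (Fin r) ℝ) ⊗ₖ
      (matOf (H *ᵥ errVec X Z) + (matOf (H *ᵥ errVec X Z))ᵀ) +
    (jacMatrix X)ᵀ * H * jacMatrix X

end LowRankRecovery

namespace LowRankRecovery

/-! ### The constraints as bilinear forms -/

/-- The bilinear form `⟨vec M, 𝐇 vec N⟩` of a matrix of order `n²`. -/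
def vecForm {n : ℕ} (H : BigMat n) (M N : Matrix (Fin n) (Fin n) ℝ) : ℝ :=
  M.vec ⬝ᵥ (H *ᵥ N.vec)

/-- The derivative `U ↦ XUᵀ + UXᵀ` of `X ↦ XXᵀ`. -/
def symProd {n r : ℕ} (X U : Matrix (Fin n) (Fin r) ℝ) : Matrix (Fin n) (Fin n) ℝ :=
  X * Uᵀ + U * Xᵀ

theorem vecForm_kernelMatrix {n m : ℕ} (A : Meas n m) (M N : Matrix (Fin n) (Fin n) ℝ) :
    vecForm (kernelMatrix A) M N = inner ℝ (A M) (A N) := by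
  rw [vecForm, kernelMatrix, ← Matrix.mulVec_mulVec, Matrix.dotProduct_mulVec,
    Matrix.vecMul_transpose, measMatrix_mulVec_vec, measMatrix_mulVec_vec, dotProduct_comm]
  rfl

theorem frobenius_norm_sq {n m : ℕ} (M : Matrix (Fin n) (Fin m) ℝ) :
    ‖M‖ ^ 2 = M.vec ⬝ᵥ M.vec := by
  rw [Matrix.frobenius_norm_def, ← Real.sqrt_eq_rpow, Real.sq_sqrt (by positivity),
    dotProduct, Fintype.sum_prod_type, Finset.sum_comm]
  simp [sq]

theorem posSemidef_iff_vec {m k : ℕ} {P : Matrix (Fin k × Fin m) (Fin k × Fin m) ℝ} :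
    P.PosSemidef ↔ Pᵀ = P ∧ ∀ U : Matrix (Fin m) (Fin k) ℝ, 0 ≤ U.vec ⬝ᵥ (P *ᵥ U.vec) := by
  rw [Matrix.posSemidef_iff_dotProduct_mulVec, Matrix.IsHermitian,
    Matrix.conjTranspose_eq_transpose_of_trivial]
  simp only [star_trivial]
  exact and_congr_right fun _ => Matrix.vec_bijective.surjective.forall

theorem loewnerBounds_iff {n : ℕ} {δ : ℝ} {H : BigMat n} (hH : Hᵀ = H) :
    LoewnerBounds δ H ↔ ∀ M : Matrix (Fin n) (Fin n) ℝ,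
      (1 - δ) * ‖M‖ ^ 2 ≤ vecForm H M M ∧ vecForm H M M ≤ (1 + δ) * ‖M‖ ^ 2 := by
  rw [LoewnerBounds, posSemidef_iff_vec, posSemidef_iff_vec, forall_and]
  simp only [Matrix.transpose_sub, Matrix.transpose_smul, Matrix.transpose_one, hH, true_and,
    Matrix.sub_mulVec, Matrix.smul_mulVec, Matrix.one_mulVec, dotProduct_sub, dotProduct_smul,
    smul_eq_mul, sub_nonneg, frobenius_norm_sq, vecForm]

theorem vec_dotProduct_jacMatrix_transpose {n r : ℕ} (X U : Matrix (Fin n) (Fin r) ℝ)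
    (v : Fin n × Fin n → ℝ) :
    U.vec ⬝ᵥ ((jacMatrix X)ᵀ *ᵥ v) = (symProd X U).vec ⬝ᵥ v := by
  rw [Matrix.dotProduct_mulVec, Matrix.vecMul_transpose, jacMatrix_mulVec_vec, symProd]

theorem jacMatrix_transpose_mulVec_eq_zero_iff {n r : ℕ} (X Z : Matrix (Fin n) (Fin r) ℝ)
    (H : BigMat n) :
    (jacMatrix X)ᵀ *ᵥ (H *ᵥ errVec X Z) = 0 ↔
      ∀ U, vecForm H (symProd X U) (X * Xᵀ - Z * Zᵀ) = 0 := by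
  rw [← dotProduct_eq_zero_iff, Matrix.vec_bijective.surjective.forall]
  simp only [dotProduct_comm _ (Matrix.vec _), vec_dotProduct_jacMatrix_transpose, vecForm, errVec]

/-- `UᵀSU` and `UᵀSᵀU` have equal trace, so the Kronecker block contributes twice the pairing of
`UUᵀ` with `S`, whether or not `S` is symmetric. -/
theorem hessMatrix_form {n r : ℕ} (X Z U : Matrix (Fin n) (Fin r) ℝ) (H : BigMat n) :
    U.vec ⬝ᵥ (hessMatrix X Z H *ᵥ U.vec) =
      2 * vecForm H (U * Uᵀ) (X * Xᵀ - Z * Zᵀ) + vecForm H (symProd X U) (symProd X U) := by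
  have hS : H *ᵥ (X * Xᵀ - Z * Zᵀ).vec = (matOf (H *ᵥ errVec X Z)).vec := rfl
  rw [hessMatrix, Matrix.add_mulVec, dotProduct_add, Matrix.mul_assoc, ← Matrix.mulVec_mulVec,
    ← Matrix.mulVec_mulVec, vec_dotProduct_jacMatrix_transpose, jacMatrix_mulVec_vec,
    Matrix.kronecker_mulVec_vec, Matrix.vec_dotProduct_vec, vecForm, vecForm, hS,
    Matrix.vec_dotProduct_vec, symProd]
  generalize matOf (H *ᵥ errVec X Z) = S
  congr 1
  have h1 : (Uᵀ * (Sᵀ * U)).trace = (Uᵀ * (S * U)).trace := by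
    rw [← Matrix.trace_transpose]
    simp [Matrix.mul_assoc]
  have h2 : (U * Uᵀ * S).trace = (Uᵀ * (S * U)).trace := by
    rw [Matrix.mul_assoc, Matrix.trace_mul_comm, Matrix.mul_assoc]
  simp [Matrix.add_mul, Matrix.mul_add, h1, h2]
  ring

theorem hessMatrix_posSemidef_iff {n r : ℕ} (X Z : Matrix (Fin n) (Fin r) ℝ) {H : BigMat n}
    (hH : Hᵀ = H) :
    (hessMatrix X Z H).PosSemidef ↔ ∀ U, 0 ≤ 2 * vecForm H (U * Uᵀ) (X * Xᵀ - Z * Zᵀ) +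
      vecForm H (symProd X U) (symProd X U) := by
  rw [posSemidef_iff_vec]
  simp only [hessMatrix_form, and_iff_right_iff_imp]
  intro _
  rw [hessMatrix, Matrix.transpose_add, ← Matrix.kroneckerMap_transpose]
  simp [Matrix.mul_assoc, hH, add_comm]

/-! ### Derivatives of the objective -/

theorem hasFDerivAt_half_quadratic {E F : Type*} [NormedAddCommGroup E] [NormedSpace ℝ E]
    [NormedAddCommGroup F] [NormedSpace ℝ F] (B : E →L[ℝ] E →L[ℝ] F)
    (hB : ∀ u v, B u v = B v u) (c : F) (y : E) :
    HasFDerivAt (fun y => (1 / 2 : ℝ) • B y y - c) (B y) y := by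
  refine ((((B.hasFDerivAt (x := y)).clm_apply (hasFDerivAt_id y)).const_smul
    (1 / 2 : ℝ)).sub_const c).congr_fderiv ?_
  ext1 u
  simp only [smul_apply, add_apply, ContinuousLinearMap.comp_apply, ContinuousLinearMap.flip_apply,
    id, ContinuousLinearMap.id_apply, hB u y, ← two_smul ℝ (B y u), smul_smul]
  norm_num

theorem fderiv_half_norm_sq_quadratic {E F : Type*} [NormedAddCommGroup E] [NormedSpace ℝ E]
    [NormedAddCommGroup F] [InnerProductSpace ℝ F] (B : E →L[ℝ] E →L[ℝ] F)
    (hB : ∀ u v, B u v = B v u) (c : F) :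
    fderiv ℝ (fun y => (1 / 2 : ℝ) * ‖(1 / 2 : ℝ) • B y y - c‖ ^ 2) =
      fun y => (innerSL ℝ ((1 / 2 : ℝ) • B y y - c)).comp (B y) := by
  ext1 y
  refine ((((hasFDerivAt_half_quadratic B hB c y).norm_sq).const_mul
    (1 / 2 : ℝ)).congr_fderiv ?_).fderiv
  rw [← Nat.cast_smul_eq_nsmul ℝ, smul_smul]
  norm_num

theorem fderiv_fderiv_half_norm_sq_quadratic {E F : Type*} [NormedAddCommGroup E]
    [NormedSpace ℝ E] [NormedAddCommGroup F] [InnerProductSpace ℝ F] (B : E →L[ℝ] E →L[ℝ] F)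
    (hB : ∀ u v, B u v = B v u) (c : F) (x u : E) :
    fderiv ℝ (fderiv ℝ (fun y => (1 / 2 : ℝ) * ‖(1 / 2 : ℝ) • B y y - c‖ ^ 2)) x u u =
      inner ℝ ((1 / 2 : ℝ) • B x x - c) (B u u) + inner ℝ (B x u) (B x u) := by
  rw [fderiv_half_norm_sq_quadratic B hB]
  have h := (((innerSL ℝ).hasFDerivAt.comp x (hasFDerivAt_half_quadratic B hB c x)).clm_comp
    (B.hasFDerivAt (x := x)))
  exact congrArg (fun T => T u u) h.fderiv

/-- With `B(X, U) = 𝒜(XUᵀ + UXᵀ)`, symmetric and bilinear, `𝒜(YYᵀ) = ½ B(Y, Y)`; the objective is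
then half the squared norm of a quadratic map. -/
theorem isSecondOrderCritical_obj_iff {n r m : ℕ} (A : Meas n m)
    (X Z : Matrix (Fin n) (Fin r) ℝ) :
    IsSecondOrderCritical (obj A Z) X ↔
      (∀ U, vecForm (kernelMatrix A) (symProd X U) (X * Xᵀ - Z * Zᵀ) = 0) ∧
      ∀ U, 0 ≤ 2 * vecForm (kernelMatrix A) (U * Uᵀ) (X * Xᵀ - Z * Zᵀ) +
        vecForm (kernelMatrix A) (symProd X U) (symProd X U) := by
  let b : Matrix (Fin n) (Fin r) ℝ →ₗ[ℝ] Matrix (Fin n) (Fin r) ℝ →ₗ[ℝ] EuclideanSpace ℝ (Fin m) :=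
    LinearMap.mk₂ ℝ (fun X U => A (symProd X U))
      (fun _ _ _ => by
        rw [← map_add]; simp only [symProd, Matrix.add_mul, Matrix.mul_add, Matrix.transpose_add]
        congr 1; abel)
      (fun _ _ _ => by rw [← map_smul]; simp [symProd])
      (fun _ _ _ => by
        rw [← map_add]; simp only [symProd, Matrix.add_mul, Matrix.mul_add, Matrix.transpose_add]
        congr 1; abel)
      (fun _ _ _ => by rw [← map_smul]; simp [symProd])
  let B := b.toContinuousBilinearMap
  have hB : ∀ U V, B U V = A (symProd U V) := fun U V => rfl
  have hBc : ∀ U V, B U V = B V U := fun U V => by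
    rw [hB, hB, symProd, symProd, add_comm]
  have hBB : ∀ U, (1 / 2 : ℝ) • B U U = A (U * Uᵀ) := fun U => by
    rw [hB, ← map_smul, symProd, ← two_smul ℝ (U * Uᵀ), smul_smul]; norm_num
  have hBB' : ∀ U, B U U = (2 : ℝ) • A (U * Uᵀ) := fun U => by
    rw [← hBB, smul_smul]; norm_num
  have hobj : obj A Z = fun Y => (1 / 2 : ℝ) * ‖(1 / 2 : ℝ) • B Y Y - A (Z * Zᵀ)‖ ^ 2 :=
    funext fun Y => by rw [obj, hBB, map_sub]
  have hq : (1 / 2 : ℝ) • B X X - A (Z * Zᵀ) = A (X * Xᵀ - Z * Zᵀ) := by rw [hBB, map_sub]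
  have h1 : fderiv ℝ (obj A Z) X = (innerSL ℝ (A (X * Xᵀ - Z * Zᵀ))).comp (B X) := by
    rw [hobj, ← hq]
    exact congrFun (fderiv_half_norm_sq_quadratic B hBc (A (Z * Zᵀ))) X
  have h2 : ∀ U, fderiv ℝ (fderiv ℝ (obj A Z)) X U U = inner ℝ (A (X * Xᵀ - Z * Zᵀ))
      ((2 : ℝ) • A (U * Uᵀ)) + inner ℝ (A (symProd X U)) (A (symProd X U)) := fun U => by
    rw [hobj, ← hq, ← hBB', ← hB]
    exact fderiv_fderiv_half_norm_sq_quadratic B hBc (A (Z * Zᵀ)) X U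
  refine and_congr ?_ (forall_congr' fun U => ?_)
  · refine Iff.trans (iff_of_eq (congrArg (· = 0) h1)) ?_
    rw [ContinuousLinearMap.ext_iff]
    refine forall_congr' fun U => ?_
    rw [vecForm_kernelMatrix, real_inner_comm]
    rfl
  · refine iff_of_eq (congrArg _ ((h2 U).trans ?_))
    rw [vecForm_kernelMatrix, vecForm_kernelMatrix, real_inner_smul_right, real_inner_comm]

/-! ### Kernel matrices are the positive semidefinite matrices -/

theorem kernelMatrix_transpose {n m : ℕ} (A : Meas n m) : (kernelMatrix A)ᵀ = kernelMatrix A := by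
  simp [kernelMatrix]

theorem kernelMatrix_posSemidef {n m : ℕ} (A : Meas n m) : (kernelMatrix A).PosSemidef := by
  have h := Matrix.posSemidef_conjTranspose_mul_self (measMatrix A)
  rwa [Matrix.conjTranspose_eq_transpose_of_trivial] at h

theorem exists_kernelMatrix_eq {n : ℕ} {H : BigMat n} (hH : H.PosSemidef) :
    ∃ (m : ℕ) (A : Meas n m), H = kernelMatrix A := by
  obtain ⟨B, rfl⟩ : ∃ B : BigMat n, H = Bᵀ * B := by
    open scoped MatrixOrder in
    obtain ⟨B, hB⟩ := CStarAlgebra.nonneg_iff_eq_star_mul_self.mp hH.nonneg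
    exact ⟨B, by rw [hB, Matrix.star_eq_conjTranspose,
      Matrix.conjTranspose_eq_transpose_of_trivial]⟩
  let e : Fin (n * n) ≃ Fin n × Fin n := finProdFinEquiv.symm
  let A : Meas n (n * n) :=
    { toFun := fun M => WithLp.toLp 2 fun i => (B *ᵥ M.vec) (e i)
      map_add' := fun M N => by ext i; simp [Matrix.mulVec_add]
      map_smul' := fun c M => by ext i; simp [Matrix.mulVec_smul] }
  have hA : measMatrix A = B.submatrix e id := by
    ext i p
    change (B *ᵥ (Matrix.single p.2 p.1 (1 : ℝ)).vec) (e i) = _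
    simp
  refine ⟨n * n, A, ?_⟩
  rw [kernelMatrix, hA, Matrix.transpose_submatrix, Matrix.submatrix_mul_equiv]
  simp

theorem lmiFeasible_iff {n r : ℕ} (X Z : Matrix (Fin n) (Fin r) ℝ) (δ : ℝ) (H : BigMat n) :
    LMIFeasible X Z δ H ↔ H.PosSemidef ∧ (jacMatrix X)ᵀ *ᵥ (H *ᵥ errVec X Z) = 0 ∧
      (hessMatrix X Z H).PosSemidef ∧ LoewnerBounds δ H := by
  constructor
  · rintro ⟨m, A, rfl, hc, hL⟩
    rw [isSecondOrderCritical_obj_iff] at hc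
    rw [jacMatrix_transpose_mulVec_eq_zero_iff,
      hessMatrix_posSemidef_iff _ _ (kernelMatrix_transpose A)]
    exact ⟨kernelMatrix_posSemidef A, hc.1, hc.2, hL⟩
  · rintro ⟨hH, hg, hh, hL⟩
    obtain ⟨m, A, rfl⟩ := exists_kernelMatrix_eq hH
    rw [jacMatrix_transpose_mulVec_eq_zero_iff] at hg
    rw [hessMatrix_posSemidef_iff _ _ (kernelMatrix_transpose A)] at hh
    exact ⟨m, A, rfl, (isSecondOrderCritical_obj_iff A X Z).2 ⟨hg, hh⟩, hL⟩

/-- The constraints of the second problem, written with the bilinear form of `𝐇`. -/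
theorem lmiFeasible_iff_vecForm {n r : ℕ} (X Z : Matrix (Fin n) (Fin r) ℝ) (δ : ℝ)
    (H : BigMat n) :
    LMIFeasible X Z δ H ↔ Hᵀ = H ∧ (∀ M, 0 ≤ vecForm H M M) ∧
      (∀ U, vecForm H (symProd X U) (X * Xᵀ - Z * Zᵀ) = 0) ∧
      (∀ U, 0 ≤ 2 * vecForm H (U * Uᵀ) (X * Xᵀ - Z * Zᵀ) +
        vecForm H (symProd X U) (symProd X U)) ∧
      ∀ M, (1 - δ) * ‖M‖ ^ 2 ≤ vecForm H M M ∧ vecForm H M M ≤ (1 + δ) * ‖M‖ ^ 2 := by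
  rw [lmiFeasible_iff, posSemidef_iff_vec, and_assoc, jacMatrix_transpose_mulVec_eq_zero_iff]
  refine and_congr_right fun hH => ?_
  rw [hessMatrix_posSemidef_iff _ _ hH, loewnerBounds_iff hH]
  rfl

/-! ### From restricted isometry to order bounds -/

theorem vecForm_add_left {n : ℕ} (H K : BigMat n) (M N : Matrix (Fin n) (Fin n) ℝ) :
    vecForm (H + K) M N = vecForm H M N + vecForm K M N := by
  rw [vecForm, Matrix.add_mulVec, dotProduct_add, vecForm, vecForm]

theorem vecForm_smul_left {n : ℕ} (a : ℝ) (H : BigMat n) (M N : Matrix (Fin n) (Fin n) ℝ) :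
    vecForm (a • H) M N = a * vecForm H M N := by
  rw [vecForm, Matrix.smul_mulVec, dotProduct_smul, vecForm, smul_eq_mul]

theorem vecForm_conj {n : ℕ} (P K : BigMat n) (M N M' N' : Matrix (Fin n) (Fin n) ℝ)
    (hM : P *ᵥ M.vec = M'.vec) (hN : P *ᵥ N.vec = N'.vec) :
    vecForm (Pᵀ * K * P) M N = vecForm K M' N' := by
  rw [vecForm, Matrix.mul_assoc, ← Matrix.mulVec_mulVec, ← Matrix.mulVec_mulVec,
    Matrix.dotProduct_mulVec, Matrix.vecMul_transpose, hM, hN, vecForm]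

/-- Every matrix with `n` rows has its columns in the range of an orthogonal projection whose rank
is at most the number of columns. -/
theorem exists_orthogonal_projection {n : ℕ} {ι : Type*} [Fintype ι]
    (C : Matrix (Fin n) ι ℝ) :
    ∃ Q : Matrix (Fin n) (Fin n) ℝ,
      Qᵀ = Q ∧ Q * Q = Q ∧ Q * C = C ∧ Q.rank ≤ Fintype.card ι := by
  let c : ι → EuclideanSpace ℝ (Fin n) := fun j => WithLp.toLp 2 (Cᵀ j)
  let K := Submodule.span ℝ (Set.range c)
  let b := stdOrthonormalBasis ℝ K
  -- The columns of `P` are an orthonormal basis of the column span, so `P * Pᵀ` is the projection.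
  let P : Matrix (Fin n) (Fin (Module.finrank ℝ K)) ℝ :=
    Matrix.of fun i k => (b k : EuclideanSpace ℝ (Fin n)) i
  have hP : Pᵀ * P = 1 := by
    ext k l
    have h := orthonormal_iff_ite.1 b.orthonormal l k
    rw [Submodule.coe_inner, PiLp.inner_apply] at h
    simpa [Matrix.mul_apply, P, Matrix.one_apply, eq_comm] using h
  refine ⟨P * Pᵀ, by simp, ?_, ?_, ?_⟩
  · rw [Matrix.mul_assoc, ← Matrix.mul_assoc Pᵀ, hP, Matrix.one_mul]
  · ext i j
    have hj : c j ∈ K := Submodule.subset_span ⟨j, rfl⟩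
    have h := congrArg (fun v : K => (v : EuclideanSpace ℝ (Fin n)) i) (b.sum_repr' ⟨c j, hj⟩)
    simp only [Submodule.coe_inner, PiLp.inner_apply] at h
    rw [Matrix.mul_assoc, Matrix.mul_apply]
    simp only [AddSubmonoidClass.coe_finsetSum, Submodule.coe_smul, WithLp.ofLp_sum,
      Finset.sum_apply, PiLp.smul_apply, smul_eq_mul] at h
    refine Eq.trans (Finset.sum_congr rfl fun k _ => ?_) h
    rw [Matrix.mul_apply, mul_comm]
    congr 1
    refine Finset.sum_congr rfl fun l _ => ?_
    simp [P, c, mul_comm]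
  · calc (P * Pᵀ).rank ≤ P.rank := Matrix.rank_mul_le_left _ _
      _ ≤ Module.finrank ℝ K := by simpa using P.rank_le_card_width
      _ ≤ Fintype.card ι := finrank_range_le_card c

/-- Restricting the kernel operator to the range of a projection `Q` that fixes `X` and `Z`, and
completing it by the identity, turns the restricted isometry inequality into order bounds. -/
theorem exists_lmiFeasible_of_ripFeasible {n r m : ℕ} {X Z : Matrix (Fin n) (Fin r) ℝ} {δ : ℝ}
    {A : Meas n m} (h : RIPFeasible X Z δ A) : ∃ H, LMIFeasible X Z δ H := by
  obtain ⟨hc, hδ, hrip⟩ := h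
  rw [isSecondOrderCritical_obj_iff] at hc
  obtain ⟨hg, hh⟩ := hc
  obtain ⟨Q, hQt, hQQ, hQC, hQr⟩ := exists_orthogonal_projection (Matrix.fromCols X Z)
  rw [Fintype.card_sum, Fintype.card_fin, ← two_mul] at hQr
  rw [Matrix.mul_fromCols, Matrix.fromCols_inj.eq_iff] at hQC
  obtain ⟨hQX, hQZ⟩ : Q * X = X ∧ Q * Z = Z := by simpa using hQC
  have hXQ : Xᵀ * Q = Xᵀ := by
    simpa [hQt] using congrArg Matrix.transpose hQX
  have hZQ : Zᵀ * Q = Zᵀ := by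
    simpa [hQt] using congrArg Matrix.transpose hQZ
  let E := X * Xᵀ - Z * Zᵀ
  have hE : Q * E * Q = E := by
    simp only [E, Matrix.mul_sub, Matrix.sub_mul, ← Matrix.mul_assoc, hQX, hQZ]
    simp only [Matrix.mul_assoc, hXQ, hZQ]
  have hD : ∀ U, Q * symProd X U * Q = symProd X (Q * U) := fun U => by
    simp only [symProd, Matrix.mul_add, Matrix.add_mul, ← Matrix.mul_assoc, hQX,
      Matrix.transpose_mul, hQt]
    simp only [Matrix.mul_assoc, hXQ]
  have hUU : ∀ U : Matrix (Fin n) (Fin r) ℝ, Q * (U * Uᵀ) * Q = Q * U * (Q * U)ᵀ := fun U => by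
    simp only [Matrix.transpose_mul, hQt, Matrix.mul_assoc]
  let P : BigMat n := Q ⊗ₖ Q
  have hP : ∀ M : Matrix (Fin n) (Fin n) ℝ, P *ᵥ M.vec = (Q * M * Q).vec := fun M => by
    rw [Matrix.kronecker_mulVec_vec, hQt]
  have hP' : ∀ M : Matrix (Fin n) (Fin n) ℝ, (1 - P) *ᵥ M.vec = (M - Q * M * Q).vec := fun M => by
    rw [Matrix.sub_mulVec, hP, Matrix.one_mulVec, Matrix.vec_sub]
  let K := kernelMatrix A
  let H : BigMat n := Pᵀ * K * P + (1 - P)ᵀ * 1 * (1 - P)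
  have hH : ∀ M N, vecForm H M N = vecForm K (Q * M * Q) (Q * N * Q) +
      (M - Q * M * Q).vec ⬝ᵥ (N - Q * N * Q).vec := fun M N => by
    rw [vecForm_add_left, vecForm_conj P K M N _ _ (hP M) (hP N),
      vecForm_conj (1 - P) 1 M N _ _ (hP' M) (hP' N), vecForm, vecForm, Matrix.one_mulVec]
  have hHE : ∀ M, vecForm H M E = vecForm K (Q * M * Q) E := fun M => by
    rw [hH, hE, sub_self, Matrix.vec_zero, dotProduct_zero, add_zero]
  have hHd : ∀ M, vecForm H M M = ‖A (Q * M * Q)‖ ^ 2 + ‖M - Q * M * Q‖ ^ 2 := fun M => by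
    rw [hH, frobenius_norm_sq, vecForm_kernelMatrix, real_inner_self_eq_norm_sq]
  have hpyth : ∀ M : Matrix (Fin n) (Fin n) ℝ,
      ‖M‖ ^ 2 = ‖Q * M * Q‖ ^ 2 + ‖M - Q * M * Q‖ ^ 2 := fun M => by
    have horth : (Q * M * Q).vec ⬝ᵥ (Q * M * Q).vec = M.vec ⬝ᵥ (Q * M * Q).vec := by
      simp only [Matrix.vec_dotProduct_vec, Matrix.transpose_mul, hQt]
      rw [Matrix.mul_assoc Q, Matrix.trace_mul_comm]
      congr 1
      simp only [Matrix.mul_assoc, hQQ]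
      simp only [← Matrix.mul_assoc Q Q, hQQ]
    simp only [frobenius_norm_sq, Matrix.vec_sub, dotProduct_sub, sub_dotProduct, horth,
      dotProduct_comm (Q * M * Q).vec M.vec]
    ring
  refine ⟨H, (lmiFeasible_iff_vecForm X Z δ H).2 ⟨?_, fun M => ?_, fun U => ?_, fun U => ?_,
    fun M => ?_⟩⟩
  · simp [H, K, kernelMatrix_transpose, Matrix.mul_assoc]
  · rw [hHd]
    positivity
  · rw [hHE, hD]
    exact hg _
  -- The Hessian form at `U` is the old one at `Q * U` plus a square.
  · rw [hHE, hH, hUU, hD, ← frobenius_norm_sq]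
    nlinarith [hh (Q * U), sq_nonneg ‖symProd X U - symProd X (Q * U)‖]
  · rw [hHd, hpyth M]
    have h1 := hrip (Q * M * Q) ((Matrix.rank_mul_le_right _ _).trans hQr)
    have h2 : 0 ≤ δ * ‖M - Q * M * Q‖ ^ 2 := by positivity
    constructor <;> linarith [h1.1, h1.2]

/-! ### Equality of the two problems -/

theorem LMIFeasible.nonneg {n r : ℕ} (hn : 0 < n) {X Z : Matrix (Fin n) (Fin r) ℝ} {δ : ℝ}
    {H : BigMat n} (h : LMIFeasible X Z δ H) : 0 ≤ δ := by
  have hL := ((lmiFeasible_iff_vecForm X Z δ H).1 h).2.2.2.2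
    (Matrix.single ⟨0, hn⟩ ⟨0, hn⟩ 1)
  have h1 : ‖(Matrix.single ⟨0, hn⟩ ⟨0, hn⟩ 1 : Matrix (Fin n) (Fin n) ℝ)‖ ^ 2 = 1 := by
    rw [frobenius_norm_sq]
    simp
  rw [h1] at hL
  linarith [hL.1, hL.2]

theorem LMIFeasible.ripFeasible {n r m : ℕ} (hn : 0 < n) {X Z : Matrix (Fin n) (Fin r) ℝ}
    {δ : ℝ} {A : Meas n m} (h : LMIFeasible X Z δ (kernelMatrix A)) : RIPFeasible X Z δ A := by
  obtain ⟨-, -, hg, hh, hL⟩ := (lmiFeasible_iff_vecForm _ _ _ _).1 h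
  refine ⟨(isSecondOrderCritical_obj_iff A X Z).2 ⟨hg, hh⟩, h.nonneg hn, fun M _ => ?_⟩
  simpa only [vecForm_kernelMatrix, real_inner_self_eq_norm_sq] using hL M

theorem setOf_ripFeasible_eq {n r : ℕ} (hn : 0 < n) (X Z : Matrix (Fin n) (Fin r) ℝ) :
    {δ : ℝ | ∃ (m : ℕ) (A : Meas n m), RIPFeasible X Z δ A} =
      {δ : ℝ | ∃ H : BigMat n, LMIFeasible X Z δ H} := by
  ext δ
  constructor
  · rintro ⟨m, A, h⟩
    exact exists_lmiFeasible_of_ripFeasible h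
  · rintro ⟨H, h⟩
    obtain ⟨m, A, rfl, -⟩ := id h
    exact ⟨m, A, h.ripFeasible hn⟩

/-! ### Convexity and attainment -/

theorem convex_lmiFeasible {n r : ℕ} (X Z : Matrix (Fin n) (Fin r) ℝ) :
    Convex ℝ {p : ℝ × BigMat n | LMIFeasible X Z p.1 p.2} := by
  rintro ⟨δ, H⟩ hp ⟨ε, K⟩ hq a b ha hb hab
  simp only [Set.mem_ofPred_eq, lmiFeasible_iff_vecForm, Prod.smul_mk, Prod.mk_add_mk,
    vecForm_add_left, vecForm_smul_left, smul_eq_mul] at hp hq ⊢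
  obtain ⟨p1, p2, p3, p4, p5⟩ := hp
  obtain ⟨q1, q2, q3, q4, q5⟩ := hq
  refine ⟨?_, fun M => ?_, fun U => ?_, fun U => ?_, fun M => ⟨?_, ?_⟩⟩
  · rw [Matrix.transpose_add, Matrix.transpose_smul, Matrix.transpose_smul, p1, q1]
  · exact add_nonneg (mul_nonneg ha (p2 M)) (mul_nonneg hb (q2 M))
  · rw [p3, q3, mul_zero, mul_zero, add_zero]
  · linarith [mul_nonneg ha (p4 U), mul_nonneg hb (q4 U)]
  · rw [← hab]
    linarith [mul_le_mul_of_nonneg_left (p5 M).1 ha, mul_le_mul_of_nonneg_left (q5 M).1 hb]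
  · rw [← hab]
    linarith [mul_le_mul_of_nonneg_left (p5 M).2 ha, mul_le_mul_of_nonneg_left (q5 M).2 hb]

theorem lmiFeasible_one_zero {n r : ℕ} (X Z : Matrix (Fin n) (Fin r) ℝ) :
    LMIFeasible X Z 1 (0 : BigMat n) := by
  have h0 : ∀ M N, vecForm (0 : BigMat n) M N = 0 := fun M N => by simp [vecForm]
  rw [lmiFeasible_iff_vecForm]
  simp only [h0, Matrix.transpose_zero]
  simp

theorem vecForm_single {n : ℕ} (H : BigMat n) (p q : Fin n × Fin n) :
    vecForm H (Matrix.single p.2 p.1 1) (Matrix.single q.2 q.1 1) = H p q := by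
  simp [vecForm]

/-- Positivity on sums and differences of two basis matrices bounds `|H p q|` by the mean of two
diagonal entries, each at most `1 + δ`. -/
theorem LMIFeasible.abs_apply_le {n r : ℕ} {X Z : Matrix (Fin n) (Fin r) ℝ} {δ : ℝ}
    {H : BigMat n} (h : LMIFeasible X Z δ H) (p q : Fin n × Fin n) : |H p q| ≤ 1 + δ := by
  obtain ⟨h1, h2, -, -, h5⟩ := (lmiFeasible_iff_vecForm _ _ _ _).1 h
  have hd : ∀ p, H p p ≤ 1 + δ := fun p => by
    have := (h5 (Matrix.single p.2 p.1 1)).2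
    rw [vecForm_single, frobenius_norm_sq] at this
    simpa using this
  have hs : H q p = H p q := congrFun (congrFun h1 p) q
  have hpl := h2 (Matrix.single p.2 p.1 1 + Matrix.single q.2 q.1 1)
  have hmi := h2 (Matrix.single p.2 p.1 1 - Matrix.single q.2 q.1 1)
  simp [vecForm, Matrix.mulVec_add, Matrix.mulVec_sub] at hpl hmi
  rw [abs_le]
  constructor <;> linarith [hd p, hd q]

theorem exists_isLeast_lmiFeasible {n r : ℕ} (hn : 0 < n) (X Z : Matrix (Fin n) (Fin r) ℝ) :
    ∃ δ, IsLeast {δ : ℝ | ∃ H : BigMat n, LMIFeasible X Z δ H} δ := by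
  let T : Set (ℝ × (Fin n × Fin n → Fin n × Fin n → ℝ)) :=
    {x | LMIFeasible X Z x.1 (Matrix.of x.2)}
  -- Since `(1, 0)` is feasible, only `0 ≤ δ ≤ 1` matters; there the entries are at most `1 + δ ≤ 2`
  -- in absolute value.
  let C : Set (ℝ × (Fin n × Fin n → Fin n × Fin n → ℝ)) :=
    Set.Icc 0 1 ×ˢ Set.univ.pi fun _ => Set.univ.pi fun _ => Set.Icc (-2) 2
  have hC : IsCompact C :=
    isCompact_Icc.prod (isCompact_univ_pi fun _ => isCompact_univ_pi fun _ => isCompact_Icc)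
  have hcont : ∀ M N, Continuous fun x : ℝ × (Fin n × Fin n → Fin n × Fin n → ℝ) =>
      vecForm (Matrix.of x.2) M N := fun M N => by
    simp only [vecForm, dotProduct, Matrix.mulVec, Matrix.of_apply]
    fun_prop
  have hT : IsClosed T := by
    simp only [T, lmiFeasible_iff_vecForm, Set.ofPred_and, Set.ofPred_forall, ← Matrix.ext_iff]
    refine IsClosed.inter ?_ (IsClosed.inter ?_ (IsClosed.inter ?_ (IsClosed.inter ?_ ?_)))
    · refine isClosed_iInter fun p => isClosed_iInter fun q => isClosed_eq ?_ ?_ <;>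
        simp only [Matrix.transpose_apply, Matrix.of_apply] <;> fun_prop
    · exact isClosed_iInter fun M => isClosed_le continuous_const (hcont _ _)
    · exact isClosed_iInter fun U => isClosed_eq (hcont _ _) continuous_const
    · exact isClosed_iInter fun U => isClosed_le continuous_const
        (((hcont _ _).const_mul 2).add (hcont _ _))
    · refine isClosed_iInter fun M => IsClosed.inter ?_ ?_
      · exact isClosed_le (by fun_prop) (hcont _ _)
      · exact isClosed_le (hcont _ _) (by fun_prop)
  have hmem : ∀ δ H, LMIFeasible X Z δ H → δ ≤ 1 →
      ((δ, H) : ℝ × (Fin n × Fin n → Fin n × Fin n → ℝ)) ∈ C ∩ T := fun δ H h hδ => by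
    refine ⟨⟨⟨h.nonneg hn, hδ⟩, fun p _ q _ => ?_⟩, h⟩
    have := abs_le.1 (h.abs_apply_le p q)
    constructor <;> simp only <;> linarith [this.1, this.2]
  obtain ⟨x, hx, hmin⟩ := (hC.inter_right hT).exists_isMinOn
    ⟨_, hmem 1 0 (lmiFeasible_one_zero X Z) le_rfl⟩ continuous_fst.continuousOn
  refine ⟨x.1, ⟨_, hx.2⟩, ?_⟩
  rintro δ ⟨H, h⟩
  rcases le_total δ 1 with hδ | hδ
  · exact hmin (hmem δ H h hδ)
  · exact hx.1.1.2.trans hδ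

end LowRankRecovery

theorem mainTheorem2 {n r : ℕ} (hn : 0 < n) (X Z : Matrix (Fin n) (Fin r) ℝ) :
    -- both minima are attained
    IsLeast {δ : ℝ | ∃ (m : ℕ) (A : LowRankRecovery.Meas n m), LowRankRecovery.RIPFeasible X Z δ A}
        (LowRankRecovery.deltaValue X Z) ∧
    IsLeast {δ : ℝ | ∃ H : LowRankRecovery.BigMat n, LowRankRecovery.LMIFeasible X Z δ H}
        (LowRankRecovery.lmiValue X Z) ∧
    -- and they are equal
    LowRankRecovery.deltaValue X Z = LowRankRecovery.lmiValue X Z ∧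
    -- every minimizer of the second problem factors, and each factor minimizes the first
    (∀ H : LowRankRecovery.BigMat n,
      LowRankRecovery.LMIFeasible X Z (LowRankRecovery.lmiValue X Z) H →
        (∃ (m : ℕ) (A : LowRankRecovery.Meas n m), H = LowRankRecovery.kernelMatrix A ∧
          LowRankRecovery.RIPFeasible X Z (LowRankRecovery.deltaValue X Z) A) ∧
        ∀ (m : ℕ) (A : LowRankRecovery.Meas n m), H = LowRankRecovery.kernelMatrix A →
          LowRankRecovery.RIPFeasible X Z (LowRankRecovery.deltaValue X Z) A) ∧
    -- the second problem is convex in `(δ, H)`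
    Convex ℝ {p : ℝ × LowRankRecovery.BigMat n | LowRankRecovery.LMIFeasible X Z p.1 p.2} ∧
    -- and its constraints are linear matrix inequalities
    (∀ (δ : ℝ) (H : LowRankRecovery.BigMat n),
      LowRankRecovery.LMIFeasible X Z δ H ↔
        H.PosSemidef ∧
        (LowRankRecovery.jacMatrix X)ᵀ *ᵥ (H *ᵥ LowRankRecovery.errVec X Z) = 0 ∧
        (LowRankRecovery.hessMatrix X Z H).PosSemidef ∧
        LowRankRecovery.LoewnerBounds δ H) := by
  have hset := LowRankRecovery.setOf_ripFeasible_eq hn X Z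
  have hval : LowRankRecovery.deltaValue X Z = LowRankRecovery.lmiValue X Z :=
    congrArg sInf hset
  have hleast : IsLeast {δ : ℝ | ∃ H : LowRankRecovery.BigMat n, LowRankRecovery.LMIFeasible X Z δ H}
      (LowRankRecovery.lmiValue X Z) := by
    obtain ⟨δ, hδ⟩ := LowRankRecovery.exists_isLeast_lmiFeasible hn X Z
    rwa [LowRankRecovery.lmiValue, hδ.csInf_eq]
  refine ⟨by rwa [hset, hval], hleast, hval, fun H hH => ⟨?_, ?_⟩,
    LowRankRecovery.convex_lmiFeasible X Z, LowRankRecovery.lmiFeasible_iff X Z⟩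
  · obtain ⟨m, A, rfl, -⟩ := id hH
    exact ⟨m, A, rfl, hval ▸ hH.ripFeasible hn⟩
  · rintro m A rfl
    exact hval ▸ hH.ripFeasible hn
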